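/- Let $F$ be an arbitrary field and let $\mathbb{O}=M_2(F)\oplus vM_2(F)$ be the split Cayley--Dickson algebra over $F$, with multiplication \[a\cdot b=ab,\qquad a\cdot vb=v(\bar a b),\qquad va\cdot b=v(ba),\qquad va\cdot vb=b\bar a\qquad(a,b\in M_2(F)),\] where $\overline{\begin{pmatrix}a&b\\c&d\end{pmatrix}}=\begin{pmatrix}d&-b\\-c&a\end{pmatrix}$, and let $e_{ij}$ be the matrix units of $M_2(F)$. A linear map $R:\mathbb{O}\to\mathbb{O}$ is a Rota--Baxter operator of weight $\lambda\in F$ if $R(x)R(y)=R(R(x)y+xR(y)+\lambda xy)$ for all $x,y\in\mathbb{O}$. If $\lambda\ne0$, it is called splitting if $\mathbb{O}=A_1\oplus A_2$ (direct sum of vector spaces) for some subalgebras $A_1,A_2$ (not required to contain the unit) with $R|_{A_1}=-\lambda\,\mathrm{id}$ and $R|_{A_2}=0$. For a Rota--Baxter operator $R$ of weight $\lambda$ put $\phi(R)=-R-\lambda\,\mathrm{id}$. Let $R_1:\mathbb{O}\to\mathbb{O}$ be the linear map that is $0$ on $Fe_{11}+Fe_{12}+Fve_{11}+Fve_{12}$,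 is $-\mathrm{id}$ on $Fe_{21}+Fve_{21}+Fve_{22}$, and satisfies $R_1(e_{22})=e_{11}$. **Theorem.** Let $R$ be a non-splitting Rota--Baxter operator of nonzero weight $\lambda$ on $\mathbb{O}$. Then there are a nonzero scalar $c\in F$ and a linear bijection $\psi:\mathbb{O}\to\mathbb{O}$ which is an automorphism or an anti-automorphism of the algebra $\mathbb{O}$ such that \[\psi\circ(cR)\circ\psi^{-1}=R_1\qquad\text{or}\qquad \psi\circ(c\,\phi(R))\circ\psi^{-1}=R_1 .\] -/

import Mathlib

/-! ### Rota-Baxter operators on (not necessarily associative) algebras -/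

section RotaBaxter

variable {F A : Type*} [Field F] [NonUnitalNonAssocRing A] [Module F A]

/-- `R` is a Rota-Baxter operator of weight `lam` on the algebra `A`. -/
def IsRotaBaxter (lam : F) (R : A →ₗ[F] A) : Prop :=
  ∀ x y : A, R x * R y = R (R x * y + x * R y + lam • (x * y))

/-- `R` is splitting (with respect to the weight `lam`): `A` is the direct sum of two subalgebras
(not required to contain a unit), `R` is `-lam • id` on the first one and `0` on the second. -/
def IsSplittingRB (lam : F) (R : A →ₗ[F] A) : Prop :=
  ∃ A₁ A₂ : NonUnitalSubalgebra F A,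
    IsCompl A₁.toSubmodule A₂.toSubmodule ∧
    (∀ x ∈ A₁, R x = -(lam • x)) ∧ (∀ x ∈ A₂, R x = 0)

/-- The transformation `φ(R) = -R - lam • id` of operators of weight `lam`. -/
def phiRB (lam : F) (R : A →ₗ[F] A) : A →ₗ[F] A :=
  -R - lam • LinearMap.id

/-- The linear bijection `ψ` is an automorphism of the algebra `A`. -/
def IsAlgAut (ψ : A ≃ₗ[F] A) : Prop :=
  ∀ x y : A, ψ (x * y) = ψ x * ψ y

/-- The linear bijection `ψ` is an anti-automorphism of the algebra `A`. -/
def IsAlgAntiAut (ψ : A ≃ₗ[F] A) : Prop :=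
  ∀ x y : A, ψ (x * y) = ψ y * ψ x

end RotaBaxter

/-! ### The split Cayley-Dickson algebra `M₂(F) + v M₂(F)` -/

/-- The symplectic involution of `M₂(F)`. -/
def sympInv {F : Type*} [Field F] (a : Matrix (Fin 2) (Fin 2) F) : Matrix (Fin 2) (Fin 2) F :=
  !![a 1 1, -(a 0 1); -(a 1 0), a 0 0]

/-- The split Cayley-Dickson algebra `M₂(F) + v M₂(F)`: the element with components `m` and `w`
stands for `m + v w`. -/
@[ext]
structure SplitOctonion (F : Type*) where
  m : Matrix (Fin 2) (Fin 2) F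
  w : Matrix (Fin 2) (Fin 2) F

namespace SplitOctonion

variable {F : Type*} [Field F]

instance : Zero (SplitOctonion F) := ⟨⟨0, 0⟩⟩
instance : Add (SplitOctonion F) := ⟨fun x y => ⟨x.m + y.m, x.w + y.w⟩⟩
instance : Neg (SplitOctonion F) := ⟨fun x => ⟨-x.m, -x.w⟩⟩
instance : Sub (SplitOctonion F) := ⟨fun x y => ⟨x.m - y.m, x.w - y.w⟩⟩
instance : SMul ℕ (SplitOctonion F) := ⟨fun n x => ⟨n • x.m, n • x.w⟩⟩
instance : SMul ℤ (SplitOctonion F) := ⟨fun n x => ⟨n • x.m, n • x.w⟩⟩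
instance : SMul F (SplitOctonion F) := ⟨fun c x => ⟨c • x.m, c • x.w⟩⟩

/-- The multiplication given by `a · b = ab`, `a · vb = v(āb)`, `va · b = v(ba)`,
`va · vb = b ā`, where the bar is the symplectic involution. -/
instance : Mul (SplitOctonion F) :=
  ⟨fun x y => ⟨x.m * y.m + y.w * sympInv x.w, sympInv x.m * y.w + y.m * x.w⟩⟩

@[simp] theorem zero_m : (0 : SplitOctonion F).m = 0 := rfl
@[simp] theorem zero_w : (0 : SplitOctonion F).w = 0 := rfl
@[simp] theorem add_m (x y : SplitOctonion F) : (x + y).m = x.m + y.m := rfl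
@[simp] theorem add_w (x y : SplitOctonion F) : (x + y).w = x.w + y.w := rfl
@[simp] theorem neg_m (x : SplitOctonion F) : (-x).m = -x.m := rfl
@[simp] theorem neg_w (x : SplitOctonion F) : (-x).w = -x.w := rfl
@[simp] theorem sub_m (x y : SplitOctonion F) : (x - y).m = x.m - y.m := rfl
@[simp] theorem sub_w (x y : SplitOctonion F) : (x - y).w = x.w - y.w := rfl
@[simp] theorem smul_m (c : F) (x : SplitOctonion F) : (c • x).m = c • x.m := rfl
@[simp] theorem smul_w (c : F) (x : SplitOctonion F) : (c • x).w = c • x.w := rfl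
@[simp] theorem mul_m (x y : SplitOctonion F) :
    (x * y).m = x.m * y.m + y.w * sympInv x.w := rfl
@[simp] theorem mul_w (x y : SplitOctonion F) :
    (x * y).w = sympInv x.m * y.w + y.m * x.w := rfl

theorem sympInv_add (a b : Matrix (Fin 2) (Fin 2) F) :
    sympInv (a + b) = sympInv a + sympInv b := by
  ext i j
  fin_cases i <;> fin_cases j <;> simp [sympInv] <;> ring

theorem sympInv_zero : sympInv (0 : Matrix (Fin 2) (Fin 2) F) = 0 := by
  ext i j
  fin_cases i <;> fin_cases j <;> simp [sympInv]

theorem toProd_injective :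
    Function.Injective (fun x : SplitOctonion F => (x.m, x.w)) := fun _ _ h =>
  SplitOctonion.ext (congrArg Prod.fst h) (congrArg Prod.snd h)

instance : AddCommGroup (SplitOctonion F) :=
  toProd_injective.addCommGroup _ rfl (fun _ _ => rfl) (fun _ => rfl) (fun _ _ => rfl)
    (fun _ _ => rfl) (fun _ _ => rfl)

instance : Module F (SplitOctonion F) :=
  toProd_injective.module F
    ({ toFun := fun x => (x.m, x.w), map_zero' := rfl, map_add' := fun _ _ => rfl } :
      SplitOctonion F →+ Matrix (Fin 2) (Fin 2) F × Matrix (Fin 2) (Fin 2) F)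
    (fun _ _ => rfl)

instance : NonUnitalNonAssocRing (SplitOctonion F) :=
  { (inferInstance : AddCommGroup (SplitOctonion F)),
    (inferInstance : Mul (SplitOctonion F)) with
    left_distrib := fun x y z => by
      ext1
      · simp only [mul_m, add_m, add_w, mul_add, add_mul]; abel
      · simp only [mul_w, add_m, add_w, mul_add, add_mul]; abel
    right_distrib := fun x y z => by
      ext1
      · simp only [mul_m, add_m, add_w, sympInv_add, mul_add, add_mul]; abel
      · simp only [mul_w, add_m, add_w, sympInv_add, mul_add, add_mul]; abel
    zero_mul := fun x => by
      ext1
      · simp only [mul_m, zero_m, zero_w, sympInv_zero, zero_mul, mul_zero, add_zero]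
      · simp only [mul_w, zero_m, zero_w, sympInv_zero, zero_mul, mul_zero, add_zero]
    mul_zero := fun x => by
      ext1
      · simp only [mul_m, zero_m, zero_w, zero_mul, mul_zero, add_zero]
      · simp only [mul_w, zero_m, zero_w, zero_mul, mul_zero, add_zero] }

theorem sympInv_smul (c : F) (a : Matrix (Fin 2) (Fin 2) F) :
    sympInv (c • a) = c • sympInv a := by
  ext i j
  fin_cases i <;> fin_cases j <;> simp [sympInv]

instance : IsScalarTower F (SplitOctonion F) (SplitOctonion F) :=
  ⟨fun c x y => by
    change (c • x) * y = c • (x * y)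
    ext1 <;> simp [sympInv_smul]⟩

instance : SMulCommClass F (SplitOctonion F) (SplitOctonion F) :=
  ⟨fun c x y => by
    change c • (x * y) = x * (c • y)
    ext1 <;> simp⟩

/-- The operator `R₁`: it is `0` on `e₁₁, e₁₂, ve₁₁, ve₁₂`, it is `-id` on `e₂₁, ve₂₁, ve₂₂`,
and it sends `e₂₂` to `e₁₁`. -/
def R₁ : SplitOctonion F →ₗ[F] SplitOctonion F where
  toFun x := ⟨!![x.m 1 1, 0; -(x.m 1 0), 0], !![0, 0; -(x.w 1 0), -(x.w 1 1)]⟩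
  map_add' x y := by
    ext i j <;> fin_cases i <;> fin_cases j <;> simp <;> ring
  map_smul' c x := by
    ext i j <;> fin_cases i <;> fin_cases j <;> simp

end SplitOctonion

/-! Scaling by `lam⁻¹` reduces to weight 1. If R² + R = 0, then the algebra is the sum of the
(-1)-eigenspace and the kernel of R, both subalgebras, so R splits. Assume R² + R ≠ 0.

Every element satisfies x² = tr(x) x - n(x). Putting this and its polarization into the Rota-Baxter
identity at (x, x) makes all products linear, and R² + R maps into the span of R(1) and 1, say R²x +
Rx = f(x) R(1) - g(x) 1 (`exists_isCoeffPair`). If g ≠ 0, then 1 is in the image of R; if f + g ≠ 0,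
then 1 is in the image of R + id. These exclude each other (`not_exists_both`), and φ exchanges g
and f + g, so up to φ one has g = 0. Then e = R(1) is a primitive idempotent with R(e) = 0, and the
image of R is totally isotropic (`IsPrimitiveRB`).

R preserves the Peirce components A₁₂ and A₂₁ of e, and -R is a projection on each. The norm form
pairs A₁₂ with A₂₁, and (x, y, z) ↦ pol(x, yz) is a nonzero trilinear form on A₁₂. Let U and W be
the kernel and the image of R on A₁₂. Any three vectors taken from U ∪ W include two from the same
summand, so UU and WW cannot both vanish. If bc ≠ 0 with b, c in W, some a in U completes a frame,
isotropy determines R on A₂₁, and the automorphism defined by the frame carries R to R₁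
(`exists_conj_eq`). If instead WW = 0 and UU ≠ 0, the standard involution, an anti-automorphism,
exchanges the Peirce components and leads back to the first case (`exists_conj_eq_or`). -/

namespace SplitOctonion

theorem ext_coord {F : Type*} {x y : SplitOctonion F}
    (h₁ : x.m 0 0 = y.m 0 0) (h₂ : x.m 0 1 = y.m 0 1) (h₃ : x.m 1 0 = y.m 1 0)
    (h₄ : x.m 1 1 = y.m 1 1) (h₅ : x.w 0 0 = y.w 0 0) (h₆ : x.w 0 1 = y.w 0 1)
    (h₇ : x.w 1 0 = y.w 1 0) (h₈ : x.w 1 1 = y.w 1 1) : x = y := by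
  ext i j <;> fin_cases i <;> fin_cases j <;> assumption

/-! ### Trace, norm, involution and alternative identities. -/

variable {F : Type*} [Field F]

instance : One (SplitOctonion F) := ⟨⟨1, 0⟩⟩

@[simp] theorem one_m : (1 : SplitOctonion F).m = 1 := rfl
@[simp] theorem one_w : (1 : SplitOctonion F).w = 0 := rfl

theorem sympInv_one : sympInv (1 : Matrix (Fin 2) (Fin 2) F) = 1 := by
  ext i j
  fin_cases i <;> fin_cases j <;> simp [sympInv]

instance : MulOneClass (SplitOctonion F) where
  one_mul x := by ext1 <;> simp [sympInv_one, sympInv_zero]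
  mul_one x := by ext1 <;> simp

theorem mul_m_apply (x y : SplitOctonion F) (i j : Fin 2) :
    (x * y).m i j = x.m i 0 * y.m 0 j + x.m i 1 * y.m 1 j +
      (y.w i 0 * sympInv x.w 0 j + y.w i 1 * sympInv x.w 1 j) := by
  simp [Matrix.mul_apply, Fin.sum_univ_two]

theorem mul_w_apply (x y : SplitOctonion F) (i j : Fin 2) :
    (x * y).w i j = sympInv x.m i 0 * y.w 0 j + sympInv x.m i 1 * y.w 1 j +
      (y.m i 0 * x.w 0 j + y.m i 1 * x.w 1 j) := by
  simp [Matrix.mul_apply, Fin.sum_univ_two]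

theorem sympInv_apply₀₀ (a : Matrix (Fin 2) (Fin 2) F) : sympInv a 0 0 = a 1 1 := rfl
theorem sympInv_apply₀₁ (a : Matrix (Fin 2) (Fin 2) F) : sympInv a 0 1 = -a 0 1 := rfl
theorem sympInv_apply₁₀ (a : Matrix (Fin 2) (Fin 2) F) : sympInv a 1 0 = -a 1 0 := rfl
theorem sympInv_apply₁₁ (a : Matrix (Fin 2) (Fin 2) F) : sympInv a 1 1 = a 0 0 := rfl

/-- The trace of the split Cayley-Dickson algebra. -/
def tr : SplitOctonion F →ₗ[F] F where
  toFun x := x.m 0 0 + x.m 1 1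
  map_add' x y := by simp; ring
  map_smul' c x := by simp; ring

theorem tr_apply (x : SplitOctonion F) : tr x = x.m 0 0 + x.m 1 1 := rfl

/-- The norm of the split Cayley-Dickson algebra. -/
def nrm (x : SplitOctonion F) : F :=
  x.m 0 0 * x.m 1 1 - x.m 0 1 * x.m 1 0 - (x.w 0 0 * x.w 1 1 - x.w 0 1 * x.w 1 0)

/-- The polar form of the norm. -/
def pol (x : SplitOctonion F) : SplitOctonion F →ₗ[F] F where
  toFun y := x.m 0 0 * y.m 1 1 + x.m 1 1 * y.m 0 0 - x.m 0 1 * y.m 1 0 - x.m 1 0 * y.m 0 1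
    - (x.w 0 0 * y.w 1 1 + x.w 1 1 * y.w 0 0 - x.w 0 1 * y.w 1 0 - x.w 1 0 * y.w 0 1)
  map_add' x y := by simp; ring
  map_smul' c x := by simp; ring

theorem pol_apply (x y : SplitOctonion F) : pol x y =
    x.m 0 0 * y.m 1 1 + x.m 1 1 * y.m 0 0 - x.m 0 1 * y.m 1 0 - x.m 1 0 * y.m 0 1
    - (x.w 0 0 * y.w 1 1 + x.w 1 1 * y.w 0 0 - x.w 0 1 * y.w 1 0 - x.w 1 0 * y.w 0 1) := rfl

theorem pol_comm (x y : SplitOctonion F) : pol x y = pol y x := by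
  simp only [pol_apply]; ring

theorem nrm_add (x y : SplitOctonion F) : nrm (x + y) = nrm x + nrm y + pol x y := by
  simp [nrm, pol_apply]; ring

theorem pol_add_left (x y z : SplitOctonion F) : pol (x + y) z = pol x z + pol y z := by
  rw [pol_comm, map_add, pol_comm z, pol_comm z]

theorem nrm_smul (c : F) (x : SplitOctonion F) : nrm (c • x) = c ^ 2 * nrm x := by
  simp [nrm]; ring

theorem nrm_one : nrm (1 : SplitOctonion F) = 1 := by simp [nrm]

theorem nrm_zero : nrm (0 : SplitOctonion F) = 0 := by simp [nrm]

theorem eq_zero_of_smul_one {c : F} (h : c • (1 : SplitOctonion F) = 0) : c = 0 := by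
  have h' := congrArg nrm h
  rw [nrm_smul, nrm_one, nrm_zero] at h'
  simpa using h'

theorem pol_smul_left (c : F) (x y : SplitOctonion F) : pol (c • x) y = c • pol x y := by
  rw [pol_comm, map_smul, pol_comm]

theorem tr_one : tr (1 : SplitOctonion F) = 2 := by
  simp [tr_apply]; norm_num

theorem pol_one (x : SplitOctonion F) : pol x 1 = tr x := by
  simp [tr_apply, pol_apply]

theorem nrm_mul (x y : SplitOctonion F) : nrm (x * y) = nrm x * nrm y := by
  simp only [nrm, mul_m_apply, mul_w_apply, sympInv_apply₀₀, sympInv_apply₀₁,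
    sympInv_apply₁₀, sympInv_apply₁₁]
  ring

theorem mul_self (x : SplitOctonion F) : x * x = tr x • x - nrm x • 1 := by
  apply ext_coord <;>
  simp [nrm, tr_apply, mul_m_apply, mul_w_apply, sympInv_apply₀₀, sympInv_apply₀₁,
    sympInv_apply₁₀, sympInv_apply₁₁, -mul_m, -mul_w] <;>
  ring

theorem mul_add_mul (x y : SplitOctonion F) :
    x * y + y * x = tr x • y + tr y • x - pol x y • 1 := by
  apply ext_coord <;>
  simp [pol_apply, tr_apply, mul_m_apply, mul_w_apply, sympInv_apply₀₀, sympInv_apply₀₁,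
    sympInv_apply₁₀, sympInv_apply₁₁, -mul_m, -mul_w] <;>
  ring

theorem left_alternative (x y : SplitOctonion F) : x * (x * y) = (x * x) * y := by
  apply ext_coord <;>
  simp only [mul_m_apply, mul_w_apply, sympInv_apply₀₀, sympInv_apply₀₁,
    sympInv_apply₁₀, sympInv_apply₁₁] <;>
  ring

theorem right_alternative (x y : SplitOctonion F) : (y * x) * x = y * (x * x) := by
  apply ext_coord <;>
  simp only [mul_m_apply, mul_w_apply, sympInv_apply₀₀, sympInv_apply₀₁,
    sympInv_apply₁₀, sympInv_apply₁₁] <;>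
  ring

theorem left_alternative_add (x y z : SplitOctonion F) :
    x * (y * z) + y * (x * z) = (x * y) * z + (y * x) * z := by
  have h := left_alternative (x + y) z
  simp only [add_mul, mul_add, left_alternative x, left_alternative y] at h
  linear_combination (norm := module) h

theorem right_alternative_add (x y z : SplitOctonion F) :
    (x * y) * z + (x * z) * y = x * (y * z) + x * (z * y) := by
  have h := right_alternative (y + z) x
  simp only [add_mul, mul_add, right_alternative y, right_alternative z] at h
  linear_combination (norm := module) h

theorem flexible (x y : SplitOctonion F) : (x * y) * x = x * (y * x) := by
  have h := left_alternative_add x y x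
  rw [right_alternative] at h
  exact (add_right_cancel h).symm

theorem middle_moufang (x y z : SplitOctonion F) :
    (x * y) * (z * x) = (x * (y * z)) * x := by
  apply ext_coord <;>
  simp only [mul_m_apply, mul_w_apply, sympInv_apply₀₀, sympInv_apply₀₁,
    sympInv_apply₁₀, sympInv_apply₁₁] <;>
  ring

/-- The standard involution. -/
def bar : SplitOctonion F ≃ₗ[F] SplitOctonion F where
  toFun x := tr x • 1 - x
  invFun x := tr x • 1 - x
  map_add' x y := by simp only [map_add]; module
  map_smul' c x := by simp only [map_smul, RingHom.id_apply, smul_eq_mul]; module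
  left_inv x := by simp only [map_sub, map_smul, tr_one, smul_eq_mul]; module
  right_inv x := by simp only [map_sub, map_smul, tr_one, smul_eq_mul]; module

theorem bar_apply (x : SplitOctonion F) : bar x = tr x • 1 - x := rfl

theorem bar_symm : (bar : SplitOctonion F ≃ₗ[F] _).symm = bar := rfl

theorem bar_mul (x y : SplitOctonion F) : bar (x * y) = bar y * bar x := by
  have h : tr (x * y) = tr x * tr y - pol x y := by
    simp only [tr_apply, pol_apply, mul_m_apply, sympInv_apply₀₀, sympInv_apply₀₁,
      sympInv_apply₁₀, sympInv_apply₁₁]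
    ring
  have h' := mul_add_mul x y
  simp only [bar_apply, h, sub_mul, mul_sub, smul_mul_assoc, mul_smul_comm, one_mul, mul_one]
  linear_combination (norm := module) -h'

theorem pol_mul_left (a x y : SplitOctonion F) : pol (a * x) y = pol x (bar a * y) := by
  have h : bar a * y = tr a • y - a * y := by
    rw [bar_apply, sub_mul, smul_mul_assoc, one_mul]
  rw [h, map_sub, map_smul, smul_eq_mul]
  simp only [pol_apply, tr_apply, mul_m_apply, mul_w_apply, sympInv_apply₀₀, sympInv_apply₀₁,
    sympInv_apply₁₀, sympInv_apply₁₁]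
  ring

theorem nrm_bar (x : SplitOctonion F) : nrm (bar x) = nrm x := by
  simp [nrm, bar_apply, tr_apply]
  ring

theorem tr_bar (x : SplitOctonion F) : tr (bar x) = tr x := by
  simp only [bar_apply, map_sub, map_smul, tr_one, smul_eq_mul]
  ring

theorem mul_mul_self (a x : SplitOctonion F) :
    (a * x) * a = pol a (bar x) • a - nrm a • bar x := by
  apply ext_coord <;>
  simp [nrm, pol_apply, bar_apply, tr_apply, mul_m_apply, mul_w_apply, sympInv_apply₀₀,
    sympInv_apply₀₁, sympInv_apply₁₀, sympInv_apply₁₁, -mul_m, -mul_w] <;>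
  ring

theorem exists_pol_ne_zero {x : SplitOctonion F} (hx : x ≠ 0) : ∃ y, pol x y ≠ 0 := by
  by_contra! h
  refine hx (ext_coord ?_ ?_ ?_ ?_ ?_ ?_ ?_ ?_)
  · simpa [pol_apply] using h ⟨!![0, 0; 0, 1], 0⟩
  · simpa [pol_apply] using h ⟨!![0, 0; 1, 0], 0⟩
  · simpa [pol_apply] using h ⟨!![0, 1; 0, 0], 0⟩
  · simpa [pol_apply] using h ⟨!![1, 0; 0, 0], 0⟩
  · simpa [pol_apply] using h ⟨0, !![0, 0; 0, 1]⟩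
  · simpa [pol_apply] using h ⟨0, !![0, 0; 1, 0]⟩
  · simpa [pol_apply] using h ⟨0, !![0, 1; 0, 0]⟩
  · simpa [pol_apply] using h ⟨0, !![1, 0; 0, 0]⟩

/-- The coordinates of the split Cayley-Dickson algebra. -/
def toProd : SplitOctonion F ≃ₗ[F] Matrix (Fin 2) (Fin 2) F × Matrix (Fin 2) (Fin 2) F where
  toFun x := (x.m, x.w)
  invFun p := ⟨p.1, p.2⟩
  map_add' _ _ := rfl
  map_smul' _ _ := rfl
  left_inv _ := rfl
  right_inv _ := rfl

instance : FiniteDimensional F (SplitOctonion F) :=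
  Module.Finite.equiv (toProd (F := F)).symm

theorem finrank_eq : Module.finrank F (SplitOctonion F) = 8 := by
  rw [(toProd (F := F)).finrank_eq]
  simp [Module.finrank_matrix]

/-! ### Rota-Baxter operators of weight one. -/

section WeightOne

variable {R : SplitOctonion F →ₗ[F] SplitOctonion F}

theorem rb_mul (hR : IsRotaBaxter (1 : F) R) (x y : SplitOctonion F) :
    R x * R y = R (R x * y + x * R y + x * y) := by
  simpa using hR x y

theorem phiRB_one_apply (x : SplitOctonion F) : phiRB (1 : F) R x = -R x - x := by
  simp [phiRB]

theorem isRotaBaxter_phiRB (hR : IsRotaBaxter (1 : F) R) : IsRotaBaxter (1 : F) (phiRB 1 R) := by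
  intro x y
  have h := rb_mul hR x y
  simp only [phiRB_one_apply, map_add, map_sub, map_neg, sub_mul, mul_sub,
    neg_mul, mul_neg, one_smul] at h ⊢
  rw [h]
  abel

theorem rb_ker_mul (hR : IsRotaBaxter (1 : F) R) {k : SplitOctonion F} (hk : R k = 0)
    (y : SplitOctonion F) : R (k * (R y + y)) = 0 := by
  have h := rb_mul hR k y
  rw [hk, zero_mul, zero_mul, zero_add, ← mul_add] at h
  exact h.symm

theorem rb_mul_ker (hR : IsRotaBaxter (1 : F) R) {k : SplitOctonion F} (hk : R k = 0)
    (y : SplitOctonion F) : R ((R y + y) * k) = 0 := by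
  have h := rb_mul hR y k
  rw [hk, mul_zero, mul_zero, add_zero, ← add_mul] at h
  exact h.symm

theorem rb_negKer_mul (hR : IsRotaBaxter (1 : F) R) {k : SplitOctonion F} (hk : R k = -k)
    (y : SplitOctonion F) : R (k * R y) = -(k * R y) := by
  have h := rb_mul hR k y
  rw [hk, neg_mul, neg_mul, neg_add_eq_sub, sub_add_cancel] at h
  exact h.symm

theorem rb_mul_negKer (hR : IsRotaBaxter (1 : F) R) {k : SplitOctonion F} (hk : R k = -k)
    (y : SplitOctonion F) : R (R y * k) = -(R y * k) := by
  have h := rb_mul hR y k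
  rw [hk, mul_neg, mul_neg, neg_add_cancel_right] at h
  exact h.symm

/-- The identity at (x, x), with x², (Rx)² and Rx·x + x·Rx replaced by their linear expressions. -/
theorem rb_sq (hR : IsRotaBaxter (1 : F) R) (x : SplitOctonion F) :
    tr x • (R (R x) + R x) = (pol x (R x) + nrm x) • R 1 - nrm (R x) • 1 := by
  have h := rb_mul hR x x
  rw [mul_self, mul_self, mul_add_mul, pol_comm] at h
  simp only [map_add, map_sub, map_smul] at h
  linear_combination (norm := module) -h

theorem rb_sq_polar (hR : IsRotaBaxter (1 : F) R) (x y : SplitOctonion F) :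
    tr x • (R (R y) + R y) + tr y • (R (R x) + R x) =
      (pol x (R y) + pol y (R x) + pol x y) • R 1 - pol (R x) (R y) • 1 := by
  have h := rb_sq hR (x + y)
  have h₁ := rb_sq hR x
  have h₂ := rb_sq hR y
  simp only [map_add, nrm_add, pol_add_left] at h
  linear_combination (norm := module) h - h₁ - h₂

theorem sq_add_self_eq_zero_of_scalar (hR : IsRotaBaxter (1 : F) R) {c : F} (hc : R 1 = c • 1)
    (x : SplitOctonion F) : R (R x) + R x = 0 := by
  have h1 : c * (c + 1) = 0 := by
    have h := rb_mul hR 1 1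
    simp only [hc, mul_one, smul_mul_assoc, one_mul, map_add, map_smul] at h
    refine eq_zero_of_smul_one ?_
    linear_combination (norm := module) -h
  have h := rb_mul hR 1 x
  simp only [hc, smul_mul_assoc, one_mul, map_add, map_smul] at h
  rcases mul_eq_zero.mp h1 with h0 | h0
  · rw [h0] at h
    linear_combination (norm := module) -h
  · rw [eq_neg_of_add_eq_zero_left h0] at h
    linear_combination (norm := module) -h

theorem coeff_eq_zero {r : SplitOctonion F} (hr : ∀ c : F, r ≠ c • 1) {a b : F}
    (h : a • r = b • 1) : a = 0 ∧ b = 0 := by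
  have ha : a = 0 := by
    by_contra ha
    refine hr (a⁻¹ * b) ?_
    rw [mul_smul, ← h, smul_smul, inv_mul_cancel₀ ha, one_smul]
  refine ⟨ha, ?_⟩
  rw [ha, zero_smul] at h
  exact eq_zero_of_smul_one h.symm

theorem coeff_ext {r : SplitOctonion F} (hr : ∀ c : F, r ≠ c • 1) {a b a' b' : F}
    (h : a • r - b • 1 = a' • r - b' • (1 : SplitOctonion F)) : a = a' ∧ b = b' := by
  have := coeff_eq_zero hr (a := a - a') (b := b - b')
    (by linear_combination (norm := module) h)
  exact ⟨sub_eq_zero.mp this.1, sub_eq_zero.mp this.2⟩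

/-- `R² + R` takes its values in the span of `R 1` and `1`, with the coefficients `f` and `-g`,
which also determine the norms of `R x` and of `R x + x`. -/
structure IsCoeffPair (R : SplitOctonion F →ₗ[F] SplitOctonion F)
    (f g : SplitOctonion F →ₗ[F] F) : Prop where
  not_scalar : ∀ c : F, R 1 ≠ c • 1
  sq_add : ∀ x, R (R x) + R x = f x • R 1 - g x • 1
  nrm_map : ∀ x, nrm (R x) = tr x * g x
  nrm_map_add : ∀ x, nrm (R x + x) = tr x * (f x + g x)

theorem exists_isCoeffPair (hR : IsRotaBaxter (1 : F) R) (hr : ∀ c : F, R 1 ≠ c • 1) :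
    ∃ f g, IsCoeffPair R f g := by
  obtain ⟨x₀, hx₀⟩ : ∃ x : SplitOctonion F, tr x = 1 :=
    ⟨⟨!![1, 0; 0, 0], 0⟩, by simp [tr_apply]⟩
  set α := pol x₀ (R x₀) + nrm x₀ with hα
  set β := nrm (R x₀) with hβ
  have h₀ := rb_sq hR x₀
  rw [hx₀, one_smul, ← hα, ← hβ] at h₀
  -- Polarizing `rb_sq` against `x₀` of trace 1 isolates R²x + Rx; no division by 2 is needed, so
  -- any characteristic is allowed.
  let f : SplitOctonion F →ₗ[F] F := pol x₀ ∘ₗ R + pol (R x₀) + pol x₀ - α • tr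
  let g : SplitOctonion F →ₗ[F] F := pol (R x₀) ∘ₗ R - β • tr
  have hf : ∀ x, f x = pol x₀ (R x) + pol x (R x₀) + pol x₀ x - α * tr x := fun x => by
    simp [f, pol_comm (R x₀)]
  have hg : ∀ x, g x = pol (R x₀) (R x) - β * tr x := fun x => by simp [g]
  have hS : ∀ x, R (R x) + R x = f x • R 1 - g x • 1 := fun x => by
    have h := rb_sq_polar hR x₀ x
    rw [hx₀, h₀] at h
    rw [hf, hg]
    linear_combination (norm := module) h
  have hfg : ∀ x, pol x (R x) + nrm x = tr x * f x ∧ nrm (R x) = tr x * g x := fun x => by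
    have h := rb_sq hR x
    rw [hS] at h
    refine coeff_ext hr ?_
    rw [← h]
    module
  refine ⟨f, g, hr, hS, fun x => (hfg x).2, fun x => ?_⟩
  rw [nrm_add, (hfg x).2, pol_comm, mul_add, ← (hfg x).1]
  ring

namespace IsCoeffPair

variable {f g : SplitOctonion F →ₗ[F] F}

/-- The new pair has g' = f + g and f' + g' = g, so φ exchanges the two norm conditions. -/
theorem phi (h : IsCoeffPair R f g) : IsCoeffPair (phiRB 1 R) (-f) (f + g) where
  not_scalar c hc := by
    rw [phiRB_one_apply] at hc
    refine h.not_scalar (-c - 1) ?_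
    linear_combination (norm := module) -hc
  sq_add x := by
    have := h.sq_add x
    simp only [phiRB_one_apply, map_sub, map_neg, LinearMap.neg_apply, LinearMap.add_apply]
    linear_combination (norm := module) this
  nrm_map x := by
    have := h.nrm_map_add x
    rw [phiRB_one_apply, LinearMap.add_apply, ← this, show -R x - x = (-1 : F) • (R x + x) by module,
      nrm_smul]
    ring
  nrm_map_add x := by
    have := h.nrm_map x
    rw [phiRB_one_apply, show -R x - x + x = (-1 : F) • R x by module, nrm_smul, this]
    simp

theorem exists_map_eq_one (h : IsCoeffPair R f g) {x : SplitOctonion F} (hx : g x ≠ 0) :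
    ∃ u, R u = 1 := by
  refine ⟨(g x)⁻¹ • (f x • 1 - R x - x), ?_⟩
  have hS := h.sq_add x
  rw [map_smul, inv_smul_eq_iff₀ hx, map_sub, map_sub, map_smul]
  linear_combination (norm := module) -hS

theorem exists_map_add_eq_one (h : IsCoeffPair R f g) {x : SplitOctonion F}
    (hx : f x + g x ≠ 0) : ∃ v, R v + v = 1 := by
  refine ⟨(f x + g x)⁻¹ • (f x • 1 - R x), ?_⟩
  have hS := h.sq_add x
  rw [map_smul, ← smul_add, inv_smul_eq_iff₀ hx, map_sub, map_smul]
  linear_combination (norm := module) -hS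

theorem pol_map (h : IsCoeffPair R f g) (x y : SplitOctonion F) :
    pol (R x) (R y) = tr x * g y + tr y * g x := by
  have h₁ := h.nrm_map (x + y)
  rw [map_add, nrm_add, h.nrm_map, h.nrm_map, map_add, map_add] at h₁
  linear_combination h₁

theorem coeff_of_map_add_eq_one (h : IsCoeffPair R f g) {v : SplitOctonion F}
    (hv : R v + v = 1) : f v = 1 ∧ g v = 0 ∧ tr v = 1 ∧ nrm v = 0 := by
  have hRv : R v = 1 - v := eq_sub_of_add_eq hv
  have hS := h.sq_add v
  rw [hRv, map_sub, hRv] at hS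
  obtain ⟨hf, hg⟩ := coeff_ext h.not_scalar (a := f v) (b := g v) (a' := 1) (b' := 0)
    (by linear_combination (norm := module) -hS)
  have ht : tr v = 1 := by
    have := h.nrm_map_add v
    rw [hv, nrm_one, hf, hg] at this
    linear_combination -this
  refine ⟨hf, hg, ht, ?_⟩
  have h1 := h.nrm_map v
  have h2 := nrm_add v (R v)
  rw [add_comm v, hv, h1, hg, nrm_one, hRv, map_sub, pol_one, ht] at h2
  have h3 := mul_self v
  have h4 := mul_add_mul v v
  rw [h3] at h4
  have h5 : 2 * nrm v - pol v v = 0 :=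
    eq_zero_of_smul_one (by linear_combination (norm := module) -h4)
  linear_combination h5 + h2

theorem map_mul_of_map_add_eq_one (hR : IsRotaBaxter (1 : F) R) {v : SplitOctonion F}
    (hv : R v + v = 1) : R (R 1 * v) = -(R 1 * v) ∧ R (v * R 1) = -(v * R 1) := by
  have hRv : R v = 1 - v := eq_sub_of_add_eq hv
  constructor
  · have h := rb_mul hR 1 v
    rw [hRv] at h
    simp only [mul_sub, mul_one, one_mul, map_add, map_sub, hRv] at h
    linear_combination (norm := module) -h
  · have h := rb_mul hR v 1
    rw [hRv] at h
    simp only [sub_mul, mul_one, one_mul, map_add, map_sub, hRv] at h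
    linear_combination (norm := module) -h

theorem tr_map_one (h : IsCoeffPair R f g) (hR : IsRotaBaxter (1 : F) R) {s : F}
    (hs : R (R 1) = s • R 1) : tr (R 1) = 2 * s + 1 ∧ nrm (R 1) = 0 := by
  have h₁ := rb_mul hR 1 1
  rw [mul_self] at h₁
  simp only [mul_one, one_mul, map_add, hs] at h₁
  refine coeff_ext h.not_scalar ?_
  linear_combination (norm := module) h₁

/-- Otherwise R acts as -1 on R(1), so tr R(1) = -1 and pol(v, R(1)) = -1. The element v·R(1) +
R(1)·v = R(1) - v + 1 lies in the (-1)-eigenspace, which forces R(1) = 0. -/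
theorem coeff_one_ne_zero (h : IsCoeffPair R f g) (hR : IsRotaBaxter (1 : F) R)
    {v : SplitOctonion F} (hv : R v + v = 1) (hg : g 1 = 0) : f 1 ≠ 0 := by
  intro hf
  have hRv : R v = 1 - v := eq_sub_of_add_eq hv
  obtain ⟨-, hgv, htv, -⟩ := h.coeff_of_map_add_eq_one hv
  have hS := h.sq_add 1
  rw [hf, hg] at hS
  have hr : R (R 1) = (-1 : F) • R 1 := by linear_combination (norm := module) hS
  obtain ⟨htr, -⟩ := h.tr_map_one hR hr
  have hp := h.pol_map v 1
  rw [hg, hgv, hRv, pol_comm, map_sub, pol_one, htr, pol_comm] at hp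
  have hm := mul_add_mul v (R 1)
  obtain ⟨h₁, h₂⟩ := map_mul_of_map_add_eq_one hR hv
  have h₃ : R (v * R 1 + R 1 * v) = -(v * R 1 + R 1 * v) := by
    rw [map_add, h₁, h₂]; abel
  have hq : pol v (R 1) = -1 := by linear_combination -hp
  rw [hm, htr, htv, hq] at h₃
  simp only [map_add, map_sub, map_smul, hr, hRv] at h₃
  refine h.not_scalar 0 ?_
  linear_combination (norm := module) h₃

theorem not_exists_both (h : IsCoeffPair R f g) (hR : IsRotaBaxter (1 : F) R)
    {u v : SplitOctonion F} (hu : R u = 1) (hv : R v + v = 1) : False := by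
  have hRv : R v = 1 - v := eq_sub_of_add_eq hv
  obtain ⟨hfv, hgv, htv, hnv⟩ := h.coeff_of_map_add_eq_one hv
  have hvv : v * v = v := by rw [mul_self, htv, hnv]; module
  obtain ⟨hfu, hgu⟩ : f u = 1 ∧ g u = -1 := by
    have hS := h.sq_add u
    rw [hu] at hS
    exact coeff_ext h.not_scalar (by linear_combination (norm := module) -hS)
  obtain ⟨h₁, h₂⟩ := map_mul_of_map_add_eq_one hR hv
  have hg : g 1 = 0 := by
    -- The combination of 1, u, v is chosen so that f and g both vanish on it; its image under R is
    -- then a (-1)-eigenvector. Multiplying that image by v = R(u - v) leaves R(1)·v + g(1) v, so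
    -- g(1) v is a (-1)-eigenvector, and R(v) + v = 1 gives g(1) = 0.
    have hz := h.sq_add (1 - f 1 • v + g 1 • (u - v))
    simp only [map_sub, map_add, map_smul, hfv, hgv, hfu, hgu, hu, hRv, smul_eq_mul] at hz
    have hk : R (R 1 - f 1 • (1 - v) + g 1 • v) = -(R 1 - f 1 • (1 - v) + g 1 • v) := by
      simp only [map_sub, map_add, map_smul, hRv]
      linear_combination (norm := module) hz
    have hkv := rb_negKer_mul hR hk (u - v)
    rw [map_sub, hu, hRv, sub_sub_cancel] at hkv
    simp only [add_mul, sub_mul, smul_mul_assoc, one_mul, hvv, sub_self, smul_zero, sub_zero,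
      map_add, map_smul, h₁, hRv] at hkv
    exact (coeff_eq_zero h.not_scalar (a := 0) (b := g 1)
      (by linear_combination (norm := module) -hkv)).2
  refine h.coeff_one_ne_zero hR hv hg ?_
  -- With g(1) = 0, f and g vanish on 1 - f(1) v, so its image under R + id lies in the kernel. The
  -- product of that image with u = (R + id)(u - v) is again in the kernel, and R(R(1)·u) = -1 then
  -- leaves f(1) = 0.
  have hz := h.sq_add (1 - f 1 • v)
  simp only [map_sub, map_smul, hfv, hgv, hg, hRv, smul_eq_mul] at hz
  have hk : R (R 1 + 1 - f 1 • 1) = 0 := by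
    simp only [map_sub, map_add, map_smul]
    linear_combination (norm := module) hz
  have hku := rb_ker_mul hR hk (u - v)
  have hru := rb_mul hR 1 u
  rw [map_sub, hu, hRv, show 1 - (1 - v) + (u - v) = u by abel] at hku
  simp only [hu, mul_one, one_mul, add_mul, sub_mul, smul_mul_assoc, map_add, map_sub,
    map_smul] at hku hru
  exact (coeff_eq_zero h.not_scalar (a := 0) (b := f 1)
    (by linear_combination (norm := module) hku + hru)).2

end IsCoeffPair

/-- The operators for which `e = R 1` is a primitive idempotent killed by `R`, the image of `R` is
totally isotropic, and `R² + R` takes its values in `F e`. -/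
structure IsPrimitiveRB (R : SplitOctonion F →ₗ[F] SplitOctonion F) (e : SplitOctonion F)
    (f : SplitOctonion F →ₗ[F] F) : Prop where
  isRotaBaxter : IsRotaBaxter (1 : F) R
  map_one : R 1 = e
  map_self : R e = 0
  tr_self : tr e = 1
  nrm_self : nrm e = 0
  sq_add : ∀ x, R (R x) + R x = f x • e
  nrm_map : ∀ x, nrm (R x) = 0
  nrm_map_add : ∀ x, nrm (R x + x) = tr x * f x

theorem IsCoeffPair.isPrimitiveRB {f : SplitOctonion F →ₗ[F] F} (h : IsCoeffPair R f 0)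
    (hR : IsRotaBaxter (1 : F) R) {x : SplitOctonion F} (hx : f x ≠ 0) :
    IsPrimitiveRB R (R 1) f := by
  obtain ⟨v, hv⟩ := h.exists_map_add_eq_one (x := x) (by simpa using hx)
  obtain ⟨hfv, -, htv, -⟩ := h.coeff_of_map_add_eq_one hv
  have hs := h.coeff_one_ne_zero hR hv rfl
  have hS := h.sq_add 1
  have hr : R (R 1) = (f 1 - 1) • R 1 := by
    rw [LinearMap.zero_apply] at hS
    linear_combination (norm := module) hS
  obtain ⟨ht, hn⟩ := h.tr_map_one hR hr
  -- Since f vanishes on this element, R(1) + (1 - f(1))·1 has norm 0, which reads f(1)(1 - f(1)) =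
  -- 0.
  have hk := h.nrm_map_add (1 - f 1 • v)
  rw [map_sub, map_smul, show R 1 - f 1 • R v + (1 - f 1 • v) = R 1 + (1 - f 1) • 1 by
    linear_combination (norm := module) -f 1 • hv, nrm_add, hn, nrm_smul, nrm_one, map_smul,
    pol_one, ht, map_sub, map_sub, map_smul, map_smul, hfv, LinearMap.zero_apply,
    smul_eq_mul, smul_eq_mul] at hk
  have hf : f 1 = 1 := by
    have : f 1 * (1 - f 1) = 0 := by linear_combination hk
    rcases mul_eq_zero.mp this with h0 | h0
    · exact absurd h0 hs
    · linear_combination -h0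
  rw [hf] at ht hr
  refine ⟨hR, rfl, ?_, ?_, hn, fun x => ?_, fun x => ?_, fun x => ?_⟩
  · rw [hr]; module
  · rw [ht]; ring
  · rw [h.sq_add]; simp
  · rw [h.nrm_map]; simp
  · rw [h.nrm_map_add]; simp

theorem exists_isPrimitiveRB (hR : IsRotaBaxter (1 : F) R) {x : SplitOctonion F}
    (hx : R (R x) + R x ≠ 0) :
    (∃ e f, IsPrimitiveRB R e f) ∨ ∃ e f, IsPrimitiveRB (phiRB 1 R) e f := by
  have hr : ∀ c : F, R 1 ≠ c • 1 := fun c hc => hx (sq_add_self_eq_zero_of_scalar hR hc x)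
  obtain ⟨f, g, h⟩ := exists_isCoeffPair hR hr
  have hS := h.sq_add x
  by_cases hg : g = 0
  · subst hg
    refine .inl ⟨_, f, h.isPrimitiveRB hR (x := x) fun hf => hx ?_⟩
    rw [hS, hf]; simp
  · right
    obtain ⟨y, hy⟩ : ∃ y, g y ≠ 0 := by
      by_contra! h'
      exact hg (LinearMap.ext h')
    obtain ⟨u, hu⟩ := h.exists_map_eq_one hy
    have hfg : f + g = 0 := by
      ext z
      by_contra hz
      obtain ⟨v, hv⟩ := h.exists_map_add_eq_one hz
      exact h.not_exists_both hR hu hv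
    have h' := h.phi
    rw [hfg] at h'
    refine ⟨_, _, h'.isPrimitiveRB (isRotaBaxter_phiRB hR) (x := x) fun hf => hx ?_⟩
    have hf0 : f x = 0 := by simpa using hf
    have hg0 : g x = 0 := by simpa [hf0] using LinearMap.congr_fun hfg x
    rw [hS, hf0, hg0]; simp

end WeightOne

/-- `e` is an idempotent different from `0` and `1`. -/
structure IsPrimIdem (e : SplitOctonion F) : Prop where
  tr_eq : tr e = 1
  nrm_eq : nrm e = 0

/-- `x` lies in the Peirce component `A₁₂` with respect to `e`. -/
structure P12 (e x : SplitOctonion F) : Prop where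
  left : e * x = x
  right : x * e = 0

/-- `x` lies in the Peirce component `A₂₁` with respect to `e`. -/
structure P21 (e x : SplitOctonion F) : Prop where
  left : e * x = 0
  right : x * e = x

/-! ### Peirce decomposition with respect to a primitive idempotent. -/

section Peirce

variable {e x y z : SplitOctonion F}

theorem IsPrimIdem.mul_self (he : IsPrimIdem e) : e * e = e := by
  rw [SplitOctonion.mul_self, he.tr_eq, he.nrm_eq]; module

theorem IsPrimIdem.one_sub (he : IsPrimIdem e) : IsPrimIdem (1 - e) where
  tr_eq := by rw [map_sub, tr_one, he.tr_eq]; ring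
  nrm_eq := by
    rw [show 1 - e = (-1 : F) • e + 1 by module, nrm_add, nrm_smul, he.nrm_eq, nrm_one, pol_one,
      map_smul, he.tr_eq]
    simp

theorem IsPrimIdem.not_scalar (he : IsPrimIdem e) (c : F) : e ≠ c • 1 := by
  intro h
  have h₁ := he.nrm_eq
  have h₂ := he.tr_eq
  rw [h, nrm_smul, nrm_one, mul_one] at h₁
  rw [h, map_smul, pow_eq_zero_iff two_ne_zero |>.mp h₁] at h₂
  simp at h₂

theorem P12.one_sub (h : P12 e x) : P21 (1 - e) x where
  left := by rw [sub_mul, one_mul, h.left, sub_self]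
  right := by rw [mul_sub, mul_one, h.right, sub_zero]

theorem P21.one_sub (h : P21 e x) : P12 (1 - e) x where
  left := by rw [sub_mul, one_mul, h.left, sub_zero]
  right := by rw [mul_sub, mul_one, h.right, sub_self]

theorem P12.of_one_sub (h : P21 (1 - e) x) : P12 e x := by
  simpa using h.one_sub

theorem P21.of_one_sub (h : P12 (1 - e) x) : P21 e x := by
  simpa using h.one_sub

theorem P12.add (hx : P12 e x) (hy : P12 e y) : P12 e (x + y) where
  left := by rw [mul_add, hx.left, hy.left]
  right := by rw [add_mul, hx.right, hy.right, add_zero]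

theorem P12.smul (hx : P12 e x) (c : F) : P12 e (c • x) where
  left := by rw [mul_smul_comm, hx.left]
  right := by rw [smul_mul_assoc, hx.right, smul_zero]

theorem P21.add (hx : P21 e x) (hy : P21 e y) : P21 e (x + y) where
  left := by rw [mul_add, hx.left, hy.left, add_zero]
  right := by rw [add_mul, hx.right, hy.right]

theorem P21.smul (hx : P21 e x) (c : F) : P21 e (c • x) where
  left := by rw [mul_smul_comm, hx.left, smul_zero]
  right := by rw [smul_mul_assoc, hx.right]

theorem P12.tr_pol (he : IsPrimIdem e) (hx : P12 e x) : tr x = 0 ∧ pol e x = 0 := by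
  have h := mul_add_mul e x
  rw [hx.left, hx.right, he.tr_eq] at h
  exact coeff_eq_zero he.not_scalar (by linear_combination (norm := module) -h)

theorem P12.tr_eq (he : IsPrimIdem e) (hx : P12 e x) : tr x = 0 := (hx.tr_pol he).1

theorem P21.tr_eq (he : IsPrimIdem e) (hx : P21 e x) : tr x = 0 := hx.one_sub.tr_eq he.one_sub

theorem P21.pol_eq (he : IsPrimIdem e) (hx : P21 e x) : pol e x = 0 := by
  have h := (hx.one_sub.tr_pol he.one_sub).2
  rw [pol_comm, map_sub, pol_one, hx.tr_eq he, pol_comm] at h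
  linear_combination -h

theorem P12.mul_self (he : IsPrimIdem e) (hx : P12 e x) : x * x = 0 := by
  have h : nrm x = 0 := by rw [← hx.left, nrm_mul, he.nrm_eq, zero_mul]
  rw [SplitOctonion.mul_self, h, hx.tr_eq he]; module

theorem P21.mul_self (he : IsPrimIdem e) (hx : P21 e x) : x * x = 0 :=
  hx.one_sub.mul_self he.one_sub

theorem P12.mul_comm (he : IsPrimIdem e) (hx : P12 e x) (hy : P12 e y) : x * y = -(y * x) := by
  have h := (hx.add hy).mul_self he
  rw [mul_add, add_mul, add_mul, hx.mul_self he, hy.mul_self he] at h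
  linear_combination (norm := module) h

theorem P21.mul_comm (he : IsPrimIdem e) (hx : P21 e x) (hy : P21 e y) : x * y = -(y * x) :=
  hx.one_sub.mul_comm he.one_sub hy.one_sub

theorem P12.mul (hx : P12 e x) (hy : P12 e y) : P21 e (x * y) where
  left := by
    have h := left_alternative_add e x y
    rw [hx.left, hx.right, hy.left, zero_mul, add_zero] at h
    exact add_eq_right.mp h
  right := by
    have h := right_alternative_add x y e
    rw [hx.right, hy.left, hy.right, zero_mul, mul_zero, add_zero, zero_add] at h
    exact h

theorem P12.mul_P21 (he : IsPrimIdem e) (hx : P12 e x) (hy : P21 e y) :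
    x * y = -pol x y • e := by
  have h := mul_add_mul x y
  rw [hx.tr_eq he, hy.tr_eq he] at h
  have h₁ := left_alternative_add e x y
  have h₂ := left_alternative_add e y x
  rw [hx.left, hx.right, hy.left, mul_zero, zero_mul, add_zero, add_zero] at h₁
  rw [hx.left, hy.left, hy.right, zero_mul, zero_add] at h₂
  have h₃ := congrArg (e * ·) h
  simp only [mul_add, mul_sub, zero_smul, mul_zero, mul_smul_comm, mul_one, h₁,
    add_eq_right.mp h₂] at h₃
  linear_combination (norm := module) h₃

theorem P21.mul_P12 (he : IsPrimIdem e) (hx : P21 e x) (hy : P12 e y) :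
    x * y = -pol x y • (1 - e) :=
  hx.one_sub.mul_P21 he.one_sub hy.one_sub

/-- Elements of A₁₂ anticommute, so linearized left alternativity gives x(yz) = y(zx); both sides
are multiples of e. -/
theorem P12.pol_mul_cyclic (he : IsPrimIdem e) (hx : P12 e x) (hy : P12 e y) (hz : P12 e z) :
    pol x (y * z) = pol y (z * x) := by
  have h := left_alternative_add x y z
  rw [hx.mul_comm he hy, neg_mul, neg_add_cancel, hx.mul_comm he hz, mul_neg,
    hx.mul_P21 he (hy.mul hz), hy.mul_P21 he (hz.mul hx)] at h
  have h' : (pol y (z * x) - pol x (y * z)) • e = (0 : F) • 1 := by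
    linear_combination (norm := module) h
  exact (sub_eq_zero.mp (coeff_eq_zero he.not_scalar h').1).symm

theorem P12.pol_mul_self (he : IsPrimIdem e) (hx : P12 e x) (hy : P12 e y) :
    pol x (x * y) = 0 ∧ pol x (y * x) = 0 := by
  have h : pol x (x * y) = 0 := by
    have h := left_alternative x y
    rw [hx.mul_self he, zero_mul, hx.mul_P21 he (hx.mul hy), ← zero_smul F (1 : SplitOctonion F)]
      at h
    exact neg_eq_zero.mp (coeff_eq_zero he.not_scalar h).1
  refine ⟨h, ?_⟩
  rw [hy.mul_comm he hx, map_neg, h, neg_zero]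

theorem isP12_component (he : IsPrimIdem e) (p : SplitOctonion F) :
    P12 e (e * p - (e * p) * e) where
  left := by rw [mul_sub, flexible, left_alternative, left_alternative, he.mul_self]
  right := by rw [sub_mul, right_alternative, he.mul_self, sub_self]

theorem isP21_component (he : IsPrimIdem e) (p : SplitOctonion F) :
    P21 e (p * e - (e * p) * e) where
  left := by rw [mul_sub, flexible, left_alternative, he.mul_self, sub_self]
  right := by rw [sub_mul, right_alternative, right_alternative, he.mul_self]

theorem exists_peirce (he : IsPrimIdem e) (p : SplitOctonion F) :
    ∃ (α β : F) (x y : SplitOctonion F), P12 e x ∧ P21 e y ∧ p = α • e + β • (1 - e) + x + y := by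
  refine ⟨pol e (bar p), pol (1 - e) (bar p), _, _, isP12_component he p, isP21_component he p, ?_⟩
  have h₁ := mul_mul_self e p
  have h₂ := mul_mul_self (1 - e) p
  rw [he.nrm_eq] at h₁
  rw [he.one_sub.nrm_eq] at h₂
  simp only [sub_mul, mul_sub, one_mul, mul_one] at h₂
  linear_combination (norm := module) h₁ + h₂

theorem P21.exists_P12 (he : IsPrimIdem e) (hz : P21 e z) (h0 : z ≠ 0) :
    ∃ x, P12 e x ∧ pol x z = 1 := by
  obtain ⟨p, hp⟩ := exists_pol_ne_zero h0
  have hx := isP12_component he p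
  refine ⟨(pol z p)⁻¹ • (e * p - (e * p) * e), hx.smul _, ?_⟩
  have h₁ : pol z (e * p) = pol z p := by
    rw [pol_comm, pol_mul_left, bar_apply, he.tr_eq, one_smul, sub_mul, one_mul, hz.left, sub_zero,
      pol_comm]
  rw [pol_comm, map_smul, map_sub, mul_mul_self, he.nrm_eq, zero_smul, sub_zero, map_smul,
    pol_comm z e, hz.pol_eq he, h₁]
  simp [hp]

theorem P12.exists_P21 (he : IsPrimIdem e) (hz : P12 e z) (h0 : z ≠ 0) :
    ∃ x, P21 e x ∧ pol x z = 1 := by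
  obtain ⟨x, hx, h⟩ := hz.one_sub.exists_P12 he.one_sub h0
  exact ⟨x, .of_one_sub hx, h⟩

/-- If all products in A₁₂ vanished, A₁₂ would be at most a line, hence so would A₂₁ by duality, and
the algebra would have dimension at most 4 instead of 8. -/
theorem exists_P12_mul_ne_zero (he : IsPrimIdem e) :
    ∃ b c, P12 e b ∧ P12 e c ∧ b * c ≠ 0 := by
  by_contra! h
  obtain ⟨a, ha, hspan⟩ : ∃ a, P12 e a ∧ ∀ b, P12 e b → ∃ c : F, b = c • a := by
    by_cases h0 : ∀ a, P12 e a → a = 0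
    · exact ⟨0, ⟨mul_zero _, zero_mul _⟩, fun b hb => ⟨0, by rw [h0 b hb, smul_zero]⟩⟩
    · push Not at h0
      obtain ⟨a, ha, ha0⟩ := h0
      obtain ⟨y, hy, hay⟩ := ha.exists_P21 he ha0
      refine ⟨a, ha, fun b hb => ⟨pol y b, ?_⟩⟩
      -- With ab = 0 this identity collapses to b = pol(y, b) a.
      have h' := left_alternative_add y a b
      rw [h a b ha hb, hy.mul_P12 he hb, hy.mul_P12 he ha, ha.mul_P21 he hy, pol_comm a y, hay,
        mul_zero, mul_smul_comm, mul_sub, mul_one, ha.right, smul_mul_assoc, smul_mul_assoc,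
        sub_mul, one_mul, hb.left] at h'
      linear_combination (norm := module) h'
  obtain ⟨w, hw⟩ : ∃ w, ∀ z, P21 e z → ∃ c : F, z = c • w := by
    have hinj : ∀ z, P21 e z → pol a z = 0 → z = 0 := by
      intro z hz haz
      by_contra h0
      obtain ⟨x, hx, hxz⟩ := hz.exists_P12 he h0
      obtain ⟨c, rfl⟩ := hspan x hx
      rw [pol_comm, map_smul, pol_comm, haz, smul_zero] at hxz
      exact zero_ne_one hxz
    by_cases h0 : ∀ z, P21 e z → pol a z = 0
    · exact ⟨0, fun z hz => ⟨0, by rw [hinj z hz (h0 z hz), smul_zero]⟩⟩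
    · push Not at h0
      obtain ⟨w, hw, haw⟩ := h0
      refine ⟨w, fun z hz => ⟨pol a z / pol a w, ?_⟩⟩
      have := hinj _ (hz.add (hw.smul (-(pol a z / pol a w)))) (by
        rw [map_add, map_smul, smul_eq_mul, neg_mul, div_mul_cancel₀ _ haw, add_neg_cancel])
      linear_combination (norm := module) this
  have hsurj : Function.Surjective (Fintype.linearCombination F ![e, 1 - e, a, w]) := by
    intro p
    obtain ⟨α, β, x, y, hx, hy, hp⟩ := exists_peirce he p
    obtain ⟨c, rfl⟩ := hspan x hx
    obtain ⟨d, rfl⟩ := hw y hy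
    refine ⟨![α, β, c, d], ?_⟩
    rw [hp]
    simp [Fintype.linearCombination_apply, Fin.sum_univ_four]
  have := LinearMap.finrank_le_finrank_of_surjective hsurj
  rw [finrank_eq] at this
  simp at this

end Peirce

/-- The elements `a`, `b`, `c` form a basis of `A₁₂`, normalized by `a (b c) = -e`. -/
structure IsFrame (e a b c : SplitOctonion F) : Prop where
  idem : IsPrimIdem e
  ha : P12 e a
  hb : P12 e b
  hc : P12 e c
  pol_eq : pol a (b * c) = 1

/-- The linear map that takes the standard frame to the frame `a`, `b`, `c`. -/
def frameMap (e a b c : SplitOctonion F) : SplitOctonion F →ₗ[F] SplitOctonion F where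
  toFun x := x.m 1 1 • 1 + (x.m 0 0 - x.m 1 1) • e + x.m 0 1 • a - x.m 1 0 • (b * c)
    - x.w 0 0 • (a * b) + x.w 0 1 • (c * a) + x.w 1 0 • b + x.w 1 1 • c
  map_add' x y := by simp; module
  map_smul' r x := by simp; module

/-! ### Frames of A₁₂ and the automorphisms they define. -/

namespace IsFrame

variable {e a b c : SplitOctonion F}

theorem cyclic (h : IsFrame e a b c) : IsFrame e b c a where
  idem := h.idem
  ha := h.hb
  hb := h.hc
  hc := h.ha
  pol_eq := by rw [← h.ha.pol_mul_cyclic h.idem h.hb h.hc, h.pol_eq]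

theorem mul_mul (h : IsFrame e a b c) : a * (b * c) = -e := by
  rw [h.ha.mul_P21 h.idem (h.hb.mul h.hc), h.pol_eq]; module

theorem mul_mul' (h : IsFrame e a b c) : (b * c) * a = e - 1 := by
  rw [(h.hb.mul h.hc).mul_P12 h.idem h.ha, pol_comm, h.pol_eq]; module

theorem mul_mul_mul (h : IsFrame e a b c) : (a * b) * (c * a) = -a := by
  rw [middle_moufang, h.mul_mul, neg_mul, h.ha.left]

theorem mul_mul_mul' (h : IsFrame e a b c) : (c * a) * (a * b) = a := by
  rw [(h.hc.mul h.ha).mul_comm h.idem (h.ha.mul h.hb), h.mul_mul_mul, neg_neg]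

theorem frameMap_mul (h : IsFrame e a b c) (x y : SplitOctonion F) :
    frameMap e a b c (x * y) = frameMap e a b c x * frameMap e a b c y := by
  have he := h.idem
  have h' := h.cyclic
  have h'' := h'.cyclic
  have hab := h.ha.mul h.hb
  have hbc := h.hb.mul h.hc
  have hca := h.hc.mul h.ha
  have z₁ : ∀ {x y : SplitOctonion F}, P12 e x → P12 e y →
      x * (x * y) = 0 ∧ x * (y * x) = 0 ∧ (x * y) * x = 0 ∧ (y * x) * x = 0 := by
    intro x y hx hy
    refine ⟨?_, ?_, ?_, ?_⟩
    · rw [left_alternative, hx.mul_self he, zero_mul]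
    · rw [← flexible, hx.mul_comm he hy, neg_mul, right_alternative, hx.mul_self he, mul_zero,
        neg_zero]
    · rw [hx.mul_comm he hy, neg_mul, right_alternative, hx.mul_self he, mul_zero, neg_zero]
    · rw [right_alternative, hx.mul_self he, mul_zero]
  obtain ⟨t₁, -, t₂, -⟩ := z₁ h.ha h.hb
  obtain ⟨-, t₃, -, t₄⟩ := z₁ h.ha h.hc
  obtain ⟨t₅, -, t₆, -⟩ := z₁ h.hb h.hc
  obtain ⟨-, t₇, -, t₈⟩ := z₁ h.hb h.ha
  obtain ⟨t₉, -, t₁₀, -⟩ := z₁ h.hc h.ha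
  obtain ⟨-, t₁₁, -, t₁₂⟩ := z₁ h.hc h.hb
  have hba := h.hb.mul_comm he h.ha
  have hcb := h.hc.mul_comm he h.hb
  have hac := h.ha.mul_comm he h.hc
  have s₁ := he.mul_self
  have s₂ := h.ha.mul_self he
  have s₃ := h.hb.mul_self he
  have s₄ := h.hc.mul_self he
  have s₅ := hab.mul_self he
  have s₆ := hbc.mul_self he
  have s₇ := hca.mul_self he
  have m₁ := h.mul_mul
  have m₂ := h'.mul_mul
  have m₃ := h''.mul_mul
  have m₄ := h.mul_mul'
  have m₅ := h'.mul_mul'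
  have m₆ := h''.mul_mul'
  have m₇ := h.mul_mul_mul
  have m₈ := h'.mul_mul_mul
  have m₉ := h''.mul_mul_mul
  have m₁₀ := h.mul_mul_mul'
  have m₁₁ := h'.mul_mul_mul'
  have m₁₂ := h''.mul_mul_mul'
  have ⟨ea, ae⟩ := h.ha
  have ⟨eb, be⟩ := h.hb
  have ⟨ec, ce⟩ := h.hc
  have ⟨ep, pe⟩ := hbc
  have ⟨eq, qe⟩ := hca
  have ⟨er, re⟩ := hab
  clear h h' h'' he hab hbc hca z₁
  simp only [frameMap, LinearMap.coe_mk, AddHom.coe_mk]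
  -- With the three products as atoms, the collected equations are the full multiplication table of
  -- the basis 1, e, a, b, c, bc, ca, ab.
  generalize hp : b * c = p at *
  generalize hq : c * a = q at *
  generalize hr : a * b = r at *
  simp only [mul_add, mul_sub, add_mul, sub_mul, smul_mul_assoc, mul_smul_comm, one_mul, mul_one,
    hba, hcb, hac, s₁, s₂, s₃, s₄, s₅, s₆, s₇, m₁, m₂, m₃, m₄, m₅, m₆, m₇, m₈, m₉, m₁₀, m₁₁, m₁₂,
    ea, ae, eb, be, ec, ce, ep, pe, eq, qe, er, re, t₁, t₂, t₃, t₄, t₅, t₆, t₇, t₈, t₉, t₁₀, t₁₁,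
    t₁₂, hp, hq, hr, mul_m_apply, mul_w_apply, sympInv_apply₀₀, sympInv_apply₀₁,
    sympInv_apply₁₀, sympInv_apply₁₁]
  module

theorem frameMap_one : frameMap e a b c 1 = 1 := by simp [frameMap]

/-- For x in the kernel, applying the map to xy + yx = tr(x) y + tr(y) x - pol(x, y) 1 leaves only
scalar conditions: tr(x) = 0, then pol(x, y) = 0 for all y, against nondegeneracy. -/
theorem frameMap_injective (h : IsFrame e a b c) : Function.Injective (frameMap e a b c) := by
  rw [injective_iff_map_eq_zero]
  intro x hx
  by_contra h0
  have key : ∀ y, tr x • frameMap e a b c y = pol x y • 1 := fun y => by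
    have h₁ := congrArg (frameMap e a b c) (mul_add_mul x y)
    simp only [map_add, map_sub, map_smul, h.frameMap_mul, hx, zero_mul, mul_zero, frameMap_one]
      at h₁
    linear_combination (norm := module) -h₁
  have htr : tr x = 0 := by
    have h₁ := key ⟨!![1, 0; 0, 0], 0⟩
    rw [show frameMap e a b c ⟨!![1, 0; 0, 0], 0⟩ = e by simp [frameMap]] at h₁
    exact (coeff_eq_zero h.idem.not_scalar h₁).1
  obtain ⟨y, hy⟩ := exists_pol_ne_zero h0
  refine hy (eq_zero_of_smul_one ?_)
  rw [← key, htr, zero_smul]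

/-- The automorphism that takes the standard frame to the frame `a`, `b`, `c`. -/
noncomputable def frameEquiv (h : IsFrame e a b c) : SplitOctonion F ≃ₗ[F] SplitOctonion F :=
  LinearEquiv.ofInjectiveEndo (frameMap e a b c) h.frameMap_injective

theorem frameEquiv_apply (h : IsFrame e a b c) (x : SplitOctonion F) :
    h.frameEquiv x = frameMap e a b c x := rfl

theorem isAlgAut_symm (h : IsFrame e a b c) : IsAlgAut h.frameEquiv.symm := by
  intro x y
  apply h.frameEquiv.injective
  rw [h.frameEquiv_apply (_ * _), h.frameMap_mul, ← h.frameEquiv_apply, ← h.frameEquiv_apply]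
  simp

theorem exists_eq (h : IsFrame e a b c) {x : SplitOctonion F} (hx : P12 e x) :
    ∃ α β γ : F, x = α • a + β • b + γ • c := by
  obtain ⟨t, rfl⟩ := h.frameEquiv.surjective x
  rw [h.frameEquiv_apply] at hx ⊢
  have h₁ : e * frameMap e a b c t = t.m 0 0 • e + t.m 0 1 • a + t.w 1 0 • b + t.w 1 1 • c := by
    simp only [frameMap, LinearMap.coe_mk, AddHom.coe_mk, mul_add, mul_sub, mul_smul_comm, mul_one,
      h.idem.mul_self, h.ha.left, h.hb.left, h.hc.left, (h.ha.mul h.hb).left,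
      (h.hb.mul h.hc).left, (h.hc.mul h.ha).left]
    module
  rw [hx.left] at h₁
  have h₂ := hx.right
  rw [h₁] at h₂
  simp only [add_mul, smul_mul_assoc, h.idem.mul_self, h.ha.right, h.hb.right, h.hc.right,
    smul_zero, add_zero] at h₂
  refine ⟨_, _, _, by rw [h₁, h₂, zero_add]⟩

theorem eq_zero_of_pol (h : IsFrame e a b c) {w : SplitOctonion F} (hw : P21 e w)
    (h₁ : pol a w = 0) (h₂ : pol b w = 0) (h₃ : pol c w = 0) : w = 0 := by
  by_contra h0
  obtain ⟨x, hx, hxw⟩ := hw.exists_P12 h.idem h0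
  obtain ⟨α, β, γ, rfl⟩ := h.exists_eq hx
  rw [pol_comm] at h₁ h₂ h₃ hxw
  simp [h₁, h₂, h₃] at hxw

end IsFrame

/-! ### Operators with R(1) a primitive idempotent. -/

namespace IsPrimitiveRB

variable {R : SplitOctonion F →ₗ[F] SplitOctonion F} {e a b c x y : SplitOctonion F}
  {f : SplitOctonion F →ₗ[F] F}

theorem idem (h : IsPrimitiveRB R e f) : IsPrimIdem e := ⟨h.tr_self, h.nrm_self⟩

theorem pol_map (h : IsPrimitiveRB R e f) (x y : SplitOctonion F) : pol (R x) (R y) = 0 := by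
  have h₁ := h.nrm_map (x + y)
  rwa [map_add, nrm_add, h.nrm_map, h.nrm_map, add_zero, zero_add] at h₁

theorem pol_map_add (h : IsPrimitiveRB R e f) (x y : SplitOctonion F) :
    pol (R x + x) (R y + y) = tr x * f y + tr y * f x := by
  have h₁ := h.nrm_map_add (x + y)
  rw [map_add, add_add_add_comm, nrm_add, h.nrm_map_add, h.nrm_map_add, map_add tr,
    map_add f] at h₁
  linear_combination h₁

theorem pol_negKer (h : IsPrimitiveRB R e f) (hx : R x = -x) (hy : R y = -y) : pol x y = 0 := by
  have := h.pol_map x y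
  rwa [hx, hy, map_neg, pol_comm, map_neg, neg_neg, pol_comm] at this

theorem pol_ker (h : IsPrimitiveRB R e f) (hx : R x = 0) (hy : R y = 0) (htx : tr x = 0)
    (hty : tr y = 0) : pol x y = 0 := by
  have := h.pol_map_add x y
  rwa [hx, hy, zero_add, zero_add, htx, hty, zero_mul, zero_mul, add_zero] at this

theorem map_mul_negKer (h : IsPrimitiveRB R e f) (hx : R x = -x) (hy : R y = -y) :
    R (x * y) = -(x * y) := by
  have := rb_negKer_mul h.isRotaBaxter hx y
  rwa [hy, mul_neg, map_neg, neg_inj] at this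

theorem map_mul_ker (h : IsPrimitiveRB R e f) (hx : R x = 0) (hy : R y = 0) :
    R (x * y) = 0 := by
  have := rb_ker_mul h.isRotaBaxter hx y
  rwa [hy, zero_add] at this

/-- Because e = R(1) is orthogonal to the image of R, polarizing the norm of Rx + x at (e, x) gives
f(x) = 0. -/
theorem map_map (h : IsPrimitiveRB R e f) (htr : tr x = 0) (hpol : pol e x = 0) :
    R (R x) = -R x := by
  have hf : f e = 0 := by
    have h₁ := h.sq_add e
    rw [h.map_self, map_zero, add_zero] at h₁
    exact (coeff_eq_zero h.idem.not_scalar (b := 0) (by rw [← h₁, zero_smul])).1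
  have h₁ := h.pol_map_add e x
  have h₂ := h.pol_map 1 x
  rw [h.map_one] at h₂
  rw [h.map_self, zero_add, map_add, h₂, hpol, hf, h.tr_self, htr] at h₁
  have h₃ := h.sq_add x
  rw [show f x = 0 by linear_combination -h₁, zero_smul] at h₃
  exact eq_neg_of_add_eq_zero_left h₃

/-- Since e is in the kernel and Rx is a (-1)-eigenvector, R(e(Rx + x)) = 0 while R(e·Rx) = -e·Rx;
hence e·Rx = Rx. The other side is similar. -/
theorem map_P12 (h : IsPrimitiveRB R e f) (hx : P12 e x) :
    P12 e (R x) ∧ R (R x) = -R x := by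
  obtain ⟨ht, hp⟩ := hx.tr_pol h.idem
  have hRR := h.map_map ht hp
  have h₁ := rb_ker_mul h.isRotaBaxter h.map_self x
  have h₂ := rb_mul_ker h.isRotaBaxter h.map_self x
  have h₃ := rb_mul_negKer h.isRotaBaxter hRR 1
  have h₄ := rb_negKer_mul h.isRotaBaxter hRR 1
  rw [h.map_one] at h₃ h₄
  rw [mul_add, hx.left, map_add, h₃] at h₁
  rw [add_mul, hx.right, add_zero, h₄] at h₂
  exact ⟨⟨neg_add_eq_zero.mp h₁, neg_eq_zero.mp h₂⟩, hRR⟩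

theorem map_P21 (h : IsPrimitiveRB R e f) (hx : P21 e x) :
    P21 e (R x) ∧ R (R x) = -R x := by
  have hRR := h.map_map (hx.tr_eq h.idem) (hx.pol_eq h.idem)
  have h₁ := rb_ker_mul h.isRotaBaxter h.map_self x
  have h₂ := rb_mul_ker h.isRotaBaxter h.map_self x
  have h₃ := rb_mul_negKer h.isRotaBaxter hRR 1
  have h₄ := rb_negKer_mul h.isRotaBaxter hRR 1
  rw [h.map_one] at h₃ h₄
  rw [mul_add, hx.left, add_zero, h₃] at h₁
  rw [add_mul, hx.right, map_add, h₄] at h₂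
  exact ⟨⟨neg_eq_zero.mp h₁, neg_add_eq_zero.mp h₂⟩, hRR⟩

theorem map_add_P12 (h : IsPrimitiveRB R e f) (hx : P12 e x) :
    P12 e (x + R x) ∧ R (x + R x) = 0 := by
  obtain ⟨h₁, h₂⟩ := h.map_P12 hx
  exact ⟨hx.add h₁, by rw [map_add, h₂, add_neg_cancel]⟩

theorem map_add_P21 (h : IsPrimitiveRB R e f) (hx : P21 e x) :
    P21 e (x + R x) ∧ R (x + R x) = 0 := by
  obtain ⟨h₁, h₂⟩ := h.map_P21 hx
  exact ⟨hx.add h₁, by rw [map_add, h₂, add_neg_cancel]⟩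

theorem pol_ker_map_mul (h : IsPrimitiveRB R e f) (hx : P12 e x) (hRx : R x = 0) (hy : P12 e y) :
    pol x (R (x * y)) = 0 ∧ pol x (R (y * x)) = 0 := by
  have key : ∀ z, P21 e z → pol x z = 0 → pol x (R z) = 0 := fun z hz hxz => by
    obtain ⟨h₁, h₂⟩ := h.map_add_P21 hz
    have := h.pol_ker hRx h₂ (hx.tr_eq h.idem) (h₁.tr_eq h.idem)
    rwa [map_add, hxz, zero_add] at this
  obtain ⟨h₁, h₂⟩ := hx.pol_mul_self h.idem hy
  exact ⟨key _ (hx.mul hy) h₁, key _ (hy.mul hx) h₂⟩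

/-- On A₂₁ an element is determined by its pairings with a, b, c. Those of R(ab) and R(ca) vanish:
with b and c by isotropy of the (-1)-eigenspace, with a by isotropy of the trace-zero part of the
kernel. -/
theorem conj_eq_of_frame (h : IsPrimitiveRB R e f) (hfr : IsFrame e a b c) (ha : R a = 0)
    (hb : R b = -b) (hc : R c = -c) : hfr.frameEquiv.symm.conj R = R₁ := by
  have hab : R (a * b) = 0 := by
    obtain ⟨h₁, h₂⟩ := h.map_P21 (hfr.ha.mul hfr.hb)
    exact hfr.eq_zero_of_pol h₁ (h.pol_ker_map_mul hfr.ha ha hfr.hb).1 (h.pol_negKer hb h₂)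
      (h.pol_negKer hc h₂)
  have hca : R (c * a) = 0 := by
    obtain ⟨h₁, h₂⟩ := h.map_P21 (hfr.hc.mul hfr.ha)
    exact hfr.eq_zero_of_pol h₁ (h.pol_ker_map_mul hfr.ha ha hfr.hc).2 (h.pol_negKer hb h₂)
      (h.pol_negKer hc h₂)
  have hbc := h.map_mul_negKer hb hc
  ext1 x
  rw [LinearEquiv.conj_apply_apply, LinearEquiv.symm_symm, LinearEquiv.symm_apply_eq,
    hfr.frameEquiv_apply, hfr.frameEquiv_apply]
  simp [frameMap, R₁, h.map_one, h.map_self, ha, hb, hc, hab, hca, hbc]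

theorem exists_conj_eq (h : IsPrimitiveRB R e f) (hb : P12 e b) (hc : P12 e c) (hRb : R b = -b)
    (hRc : R c = -c) (hbc : b * c ≠ 0) :
    ∃ ψ : SplitOctonion F ≃ₗ[F] SplitOctonion F, IsAlgAut ψ ∧ ψ.conj R = R₁ := by
  obtain ⟨a, ha, hab⟩ := (hb.mul hc).exists_P12 h.idem hbc
  -- Replacing a by a + Ra moves it into the kernel and keeps the pairing with bc, since Ra and bc
  -- are both (-1)-eigenvectors.
  obtain ⟨h₁, h₂⟩ := h.map_add_P12 ha
  have h₃ := h.pol_negKer (h.map_P12 ha).2 (h.map_mul_negKer hRb hRc)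
  have hfr : IsFrame e (a + R a) b c := ⟨h.idem, h₁, hb, hc, by
    rw [pol_add_left, hab, h₃, add_zero]⟩
  exact ⟨_, hfr.isAlgAut_symm, h.conj_eq_of_frame hfr h₂ hRb hRc⟩

theorem bar_conj (h : IsPrimitiveRB R e f) :
    IsPrimitiveRB (bar.conj R) (1 - e) (f ∘ₗ (bar : SplitOctonion F ≃ₗ[F] _).toLinearMap) := by
  have happ : ∀ x, bar.conj R x = bar (R (bar x)) := fun x => by
    rw [LinearEquiv.conj_apply_apply, bar_symm]
  have hbb : ∀ x : SplitOctonion F, bar (bar x) = x := bar.left_inv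
  have hb1 : bar (1 : SplitOctonion F) = 1 := by rw [bar_apply, tr_one]; module
  have hbe : bar e = 1 - e := by rw [bar_apply, h.tr_self, one_smul]
  have hbe' : bar (1 - e) = e := by rw [← hbe, hbb]
  refine ⟨fun x y => ?_, ?_, ?_, h.idem.one_sub.tr_eq, h.idem.one_sub.nrm_eq, fun x => ?_,
    fun x => ?_, fun x => ?_⟩
  · have := rb_mul h.isRotaBaxter (bar y) (bar x)
    rw [happ, happ, happ, ← bar_mul, this, one_smul]
    simp only [map_add, bar_mul, hbb]
    abel
  · rw [happ, hb1, h.map_one, hbe]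
  · rw [happ, hbe', h.map_self, map_zero]
  · rw [happ, happ, hbb, ← map_add, h.sq_add, map_smul, hbe]; rfl
  · rw [happ, nrm_bar, h.nrm_map]
  · have := h.nrm_map_add (bar x)
    rw [tr_bar, ← nrm_bar, map_add, hbb] at this
    rw [happ, this]; rfl

theorem exists_conj_eq_or (h : IsPrimitiveRB R e f) :
    ∃ ψ : SplitOctonion F ≃ₗ[F] SplitOctonion F,
      (IsAlgAut ψ ∨ IsAlgAntiAut ψ) ∧ ψ.conj R = R₁ := by
  have he := h.idem
  by_cases hW : ∃ b c, P12 e b ∧ P12 e c ∧ R b = -b ∧ R c = -c ∧ b * c ≠ 0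
  · obtain ⟨b, c, hb, hc, hRb, hRc, hbc⟩ := hW
    obtain ⟨ψ, hψ, h'⟩ := h.exists_conj_eq hb hc hRb hRc hbc
    exact ⟨ψ, .inl hψ, h'⟩
  push Not at hW
  obtain ⟨a₁, a₂, h₁, h₂, hR₁, hR₂, h₁₂⟩ :
      ∃ b c, P12 e b ∧ P12 e c ∧ R b = 0 ∧ R c = 0 ∧ b * c ≠ 0 := by
    by_contra! hU
    obtain ⟨b, c, hb, hc, hbc⟩ := exists_P12_mul_ne_zero he
    obtain ⟨a, ha, habc⟩ := (hb.mul hc).exists_P12 he hbc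
    have hW' : ∀ {x y}, P12 e x → P12 e y → R x * R y = 0 := fun hx hy =>
      hW _ _ (h.map_P12 hx).1 (h.map_P12 hy).1 (h.map_P12 hx).2 (h.map_P12 hy).2
    have hU' : ∀ {x y}, P12 e x → P12 e y → (x + R x) * (y + R y) = 0 := fun hx hy =>
      hU _ _ (h.map_add_P12 hx).1 (h.map_add_P12 hy).1 (h.map_add_P12 hx).2 (h.map_add_P12 hy).2
    -- One vanishing product kills the trilinear form, by cyclicity. Each of the eight terms in the
    -- expansion of pol(a, bc) along U + W has two arguments in the same summand.
    have key : ∀ {x y z}, P12 e x → P12 e y → P12 e z → (x * y = 0 ∨ y * z = 0 ∨ z * x = 0) →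
        pol x (y * z) = 0 := by
      rintro x y z hx hy hz (h0 | h0 | h0)
      · rw [hx.pol_mul_cyclic he hy hz, hy.pol_mul_cyclic he hz hx, h0, map_zero]
      · rw [h0, map_zero]
      · rw [hx.pol_mul_cyclic he hy hz, h0, map_zero]
    have split : ∀ x : SplitOctonion F, x = (x + R x) + (-1 : F) • R x := fun x => by module
    have ua := (h.map_add_P12 ha).1
    have ub := (h.map_add_P12 hb).1
    have uc := (h.map_add_P12 hc).1
    have wa := (h.map_P12 ha).1
    have wb := (h.map_P12 hb).1
    have wc := (h.map_P12 hc).1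
    rw [split a, split b, split c] at habc
    generalize hxa : a + R a = xa at *
    generalize hxb : b + R b = xb at *
    generalize hxc : c + R c = xc at *
    have e₁ : xa * xb = 0 := by rw [← hxa, ← hxb, hU' ha hb]
    have e₂ : xb * xc = 0 := by rw [← hxb, ← hxc, hU' hb hc]
    have e₃ : xc * xa = 0 := by rw [← hxc, ← hxa, hU' hc ha]
    have k₁ := key ua wb uc (.inr (.inr e₃))
    have k₂ := key ua ub wc (.inl e₁)
    have k₃ := key wa wb uc (.inl (hW' ha hb))
    have k₄ := key wa ub wc (.inr (.inr (hW' hc ha)))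
    simp only [mul_add, add_mul, pol_add_left, pol_smul_left, map_add, map_zero, smul_mul_assoc,
      mul_smul_comm, map_smul, smul_zero, add_zero, e₂, hW' hb hc, k₁, k₂, k₃, k₄] at habc
    exact zero_ne_one habc
  obtain ⟨w₀, hw₀, hpol⟩ := (h₁.mul h₂).exists_P12 he h₁₂
  obtain ⟨hu, hRu⟩ := h.map_add_P12 hw₀
  obtain ⟨hw, hRw⟩ := h.map_P12 hw₀
  -- The kernel part of `w₀` is orthogonal to a₁a₂, which is also in the kernel, so -R(w₀) alone
  -- carries the pairing 1.
  have hpu := h.pol_ker hRu (h.map_mul_ker hR₁ hR₂) (hu.tr_eq he) ((h₁.mul h₂).tr_eq he)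
  rw [pol_add_left, hpol] at hpu
  have hw' := hw.smul (-1)
  have hRw' : R ((-1 : F) • R w₀) = -((-1 : F) • R w₀) := by
    rw [map_smul, hRw, smul_neg]
  have hpw : pol ((-1 : F) • R w₀) (a₁ * a₂) = 1 := by
    rw [pol_comm, map_smul, pol_comm, smul_eq_mul]
    linear_combination -hpu
  generalize (-1 : F) • R w₀ = w at hw' hRw' hpw
  have hfr : IsFrame e a₁ a₂ w := (IsFrame.mk he hw' h₁ h₂ hpw).cyclic
  have hWR : ∀ {y}, P21 e y → pol w y = 0 → pol w (y + R y) = 0 := fun hy hwy => by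
    rw [map_add, hwy, h.pol_negKer hRw' (h.map_P21 hy).2, add_zero]
  have hUR : ∀ {x y}, P12 e x → R x = 0 → P21 e y → pol x (y + R y) = 0 := fun hx hRx hy =>
    h.pol_ker hRx (h.map_add_P21 hy).2 (hx.tr_eq he) ((h.map_add_P21 hy).1.tr_eq he)
  -- Here y + Ry pairs to zero with the whole frame: with a₁ and a₂ as kernel elements, with w
  -- because y and Ry both do.
  have hneg : ∀ {y}, P21 e y → pol w y = 0 → R y = -y := fun {y} hy hwy => by
    refine eq_neg_of_add_eq_zero_right (hfr.eq_zero_of_pol (h.map_add_P21 hy).1 ?_ ?_ ?_)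
    exacts [hUR h₁ hR₁ hy, hUR h₂ hR₂ hy, hWR hy hwy]
  have hp := h₂.mul hw'
  have hq := hw'.mul h₁
  have hRp := hneg hp (hw'.pol_mul_self he h₂).2
  have hRq := hneg hq (hw'.pol_mul_self he h₁).1
  have hbar : ∀ {y}, P21 e y → bar y = -y := fun {y} hy => by
    rw [bar_apply, hy.tr_eq he, zero_smul, zero_sub]
  have hconj : ∀ {y}, P21 e y → R y = -y → bar.conj R y = -y := fun {y} hy hRy => by
    rw [LinearEquiv.conj_apply_apply, bar_symm, hbar hy, map_neg, hRy, neg_neg, hbar hy]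
  -- A₂₁ of e is A₁₂ of 1 - e, and the involution acts on it as -1. So wa₁ and a₂w serve as b and c,
  -- with product -w ≠ 0.
  obtain ⟨ψ, hψ, h'⟩ := h.bar_conj.exists_conj_eq hq.one_sub hp.one_sub (hconj hq hRq)
    (hconj hp hRp) (by
      rw [hfr.cyclic.cyclic.mul_mul_mul, neg_ne_zero]
      rintro rfl
      rw [mul_zero, ← neg_zero] at hRp
      simpa using hfr.pol_eq)
  refine ⟨bar.trans ψ, .inr fun x y => ?_, ?_⟩
  · rw [LinearEquiv.trans_apply, bar_mul, hψ]; rfl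
  · rw [← h']; rfl

end IsPrimitiveRB

/-! ### Splitting criterion and return to arbitrary weight. -/

theorem isSplittingRB_of_sq {lam : F} (hlam : lam ≠ 0)
    {R : SplitOctonion F →ₗ[F] SplitOctonion F} (hR : IsRotaBaxter lam R)
    (h : ∀ x, R (R x) + lam • R x = 0) : IsSplittingRB lam R := by
  refine ⟨
    { carrier := {x | R x = -(lam • x)}
      add_mem' := fun {x y} hx hy => ?_
      zero_mem' := by simp
      mul_mem' := fun {x y} hx hy => ?_
      smul_mem' := fun c x hx => ?_ },
    { carrier := {x | R x = 0}
      add_mem' := fun {x y} hx hy => ?_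
      zero_mem' := by simp
      mul_mem' := fun {x y} hx hy => ?_
      smul_mem' := fun c x hx => ?_ }, ?_, fun x hx => hx, fun x hx => hx⟩
  · simp only [Set.mem_ofPred_eq] at *
    rw [map_add, hx, hy, smul_add, neg_add]
  · simp only [Set.mem_ofPred_eq] at *
    have h₁ := hR x y
    rw [hx, hy, neg_mul_neg, smul_mul_smul_comm, neg_mul, mul_neg, smul_mul_assoc, mul_smul_comm,
      neg_add_cancel_right, map_neg, map_smul, mul_smul, ← smul_neg] at h₁
    exact neg_eq_iff_eq_neg.mp (smul_right_injective _ hlam h₁).symm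
  · simp only [Set.mem_ofPred_eq] at *
    rw [map_smul, hx, smul_neg, smul_comm]
  · simp only [Set.mem_ofPred_eq] at *
    rw [map_add, hx, hy, add_zero]
  · simp only [Set.mem_ofPred_eq] at *
    have h₁ := hR x y
    rw [hx, hy, zero_mul, zero_mul, mul_zero, add_zero, zero_add, map_smul] at h₁
    exact (smul_eq_zero_iff_right hlam).mp h₁.symm
  · simp only [Set.mem_ofPred_eq] at *
    rw [map_smul, hx, smul_zero]
  · constructor
    · rw [Submodule.disjoint_def]
      intro x hx hy
      have hx' : R x = -(lam • x) := hx
      have hy' : R x = 0 := hy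
      rw [hy', zero_eq_neg] at hx'
      exact (smul_eq_zero_iff_right hlam).mp hx'
    · rw [Submodule.codisjoint_iff_exists_add_eq]
      intro x
      -- By R² = -lam R, the map -lam⁻¹ R is the projection onto the (-lam)-eigenspace along the
      -- kernel.
      refine ⟨-(lam⁻¹ • R x), x + lam⁻¹ • R x, ?_, ?_, by abel⟩
      · change R (-(lam⁻¹ • R x)) = -(lam • -(lam⁻¹ • R x))
        rw [map_neg, map_smul, eq_neg_of_add_eq_zero_left (h x)]
        module
      · change R (x + lam⁻¹ • R x) = 0
        rw [map_add, map_smul, eq_neg_of_add_eq_zero_left (h x), smul_neg, smul_smul,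
          inv_mul_cancel₀ hlam, one_smul, add_neg_cancel]

end SplitOctonion

theorem theorem1 {F : Type*} [Field F] (lam : F) (hlam : lam ≠ 0)
    (R : SplitOctonion F →ₗ[F] SplitOctonion F)
    (hR : IsRotaBaxter lam R) (hns : ¬ IsSplittingRB lam R) :
    ∃ (c : F) (ψ : SplitOctonion F ≃ₗ[F] SplitOctonion F),
      c ≠ 0 ∧ (IsAlgAut ψ ∨ IsAlgAntiAut ψ) ∧
      (ψ.conj (c • R) = SplitOctonion.R₁ ∨
        ψ.conj (c • phiRB lam R) = SplitOctonion.R₁) := by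
  have hR' : IsRotaBaxter (1 : F) (lam⁻¹ • R) := fun x y => by
    have h : x * y = lam⁻¹ • lam • (x * y) := by rw [inv_smul_smul₀ hlam]
    simp only [LinearMap.smul_apply, smul_mul_assoc, mul_smul_comm, one_smul]
    rw [hR x y]
    nth_rw 2 [h]
    rw [← smul_add, ← smul_add, map_smul]
  have hphi : phiRB 1 (lam⁻¹ • R) = lam⁻¹ • phiRB lam R := by
    rw [phiRB, phiRB, smul_sub, smul_smul, inv_mul_cancel₀ hlam, smul_neg]
  obtain ⟨x, hx⟩ : ∃ x, R (R x) + lam • R x ≠ 0 := by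
    by_contra! h
    exact hns (SplitOctonion.isSplittingRB_of_sq hlam hR h)
  have hx' : (lam⁻¹ • R) ((lam⁻¹ • R) x) + (lam⁻¹ • R) x ≠ 0 := fun h0 => hx <| by
    have h₁ : lam⁻¹ • lam⁻¹ • (R (R x) + lam • R x) = 0 := by
      rw [← h0, smul_add, inv_smul_smul₀ hlam, smul_add]
      simp
    have hl := inv_ne_zero hlam
    exact (smul_eq_zero_iff_right hl).mp ((smul_eq_zero_iff_right hl).mp h₁)
  refine ⟨lam⁻¹, ?_⟩
  rw [← hphi]
  rcases SplitOctonion.exists_isPrimitiveRB hR' hx' with ⟨e, f, h⟩ | ⟨e, f, h⟩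
  · obtain ⟨ψ, hψ, h'⟩ := h.exists_conj_eq_or
    exact ⟨ψ, inv_ne_zero hlam, hψ, .inl h'⟩
  · obtain ⟨ψ, hψ, h'⟩ := h.exists_conj_eq_or
    exact ⟨ψ, inv_ne_zero hlam, hψ, .inr h'⟩
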